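/- Let $G$ be a complete signed graph on a finite node set $V$ (each pair of distinct nodes is joined by an edge that is either positive or negative), structurally balanced under a partition $V=V_1\cup V_2$ into two disjoint nonempty sets: every edge inside $V_1$ or inside $V_2$ is positive, and every edge between $V_1$ and $V_2$ is negative. Let $\alpha\in(0,1/2)$, $\beta>0$, $c>0$. Let $\mathcal F_c(z)=-c$ if $z<-c$, $\mathcal F_c(z)=z$ if $-c\le z\le c$, and $\mathcal F_c(z)=c$ if $z>c$. Put $\theta(\{i,j\})=\alpha$ if $\{i,j\}$ is a positive edge and $\theta(\{i,j\})=-\beta$ if it is a negative edge. At each time $t=0,1,2,\dots$ an edge is drawn at random, independently over time, from a fixed probability distribution $p$ that gives positive probability to every edge (for instance the uniform one). If $\{i,j\}$ is the edge drawn at time $t$ and $\theta=\theta(\{i,j\})$, then both endpoints update simultaneously, $$x_i(t+1)=\mathcal F_c\big((1-\theta)x_i(t)+\theta x_j(t)\big),\qquad x_j(t+1)=\mathcal F_c\big((1-\theta)x_j(t)+\theta x_i(t)\big),$$ and all other nodes keep their values. Then there is $\beta_*>0$, depending only on $G$, $p$ and $\alpha$, such that for all $\beta>\beta_*$ and all $c>0$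 the following holds: for Lebesgue-almost every initial value $x(0)\in[-c,c]^V$ there is a random variable $l=l(x(0))$ with values in $\{-c,c\}$ such that $$\mathbb P\Big(\lim_{t\to\infty}x_i(t)=l\ \text{ for all } i\in V_1\ \text{ and }\ \lim_{t\to\infty}x_i(t)=-l\ \text{ for all } i\in V_2\Big)=1.$$ -/

import Mathlib

open MeasureTheory ProbabilityTheory Filter Topology

/-- A signed graph: every edge is either positive or negative, never both. -/
structure SignedGraph (V : Type*) where
  pos : SimpleGraph V
  neg : SimpleGraph V
  disjoint : Disjoint pos neg

namespace SignedGraph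

variable {V : Type*}

/-- The underlying unsigned graph. -/
def graph (G : SignedGraph V) : SimpleGraph V := G.pos ⊔ G.neg

/-- Any two distinct nodes are joined by an edge. -/
def IsComplete (G : SignedGraph V) : Prop := G.graph = ⊤

/-- `G` is structurally balanced under the partition `V = V₁ ∪ V₂`. -/
structure IsStructurallyBalanced (G : SignedGraph V) (V₁ V₂ : Set V) : Prop where
  nonempty_left : V₁.Nonempty
  nonempty_right : V₂.Nonempty
  disjoint : Disjoint V₁ V₂
  union_eq : V₁ ∪ V₂ = Set.univ
  pos_left : ∀ i ∈ V₁, ∀ j ∈ V₁, G.graph.Adj i j → G.pos.Adj i j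
  pos_right : ∀ i ∈ V₂, ∀ j ∈ V₂, G.graph.Adj i j → G.pos.Adj i j
  neg_between : ∀ i ∈ V₁, ∀ j ∈ V₂, G.graph.Adj i j → G.neg.Adj i j

open Classical in
/-- The interaction weight: `α` on positive edges and `-β` on negative edges
(the value `0` on pairs that are not edges is never used). -/
noncomputable def weight (G : SignedGraph V) (α β : ℝ) (e : Sym2 V) : ℝ :=
  if e ∈ G.pos.edgeSet then α else if e ∈ G.neg.edgeSet then -β else 0

/-- The clipping function to `[-c, c]`. -/
noncomputable def clip (c z : ℝ) : ℝ :=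
  if z < -c then -c else if c < z then c else z

open Classical in
/-- One interaction along the pair `e`: both endpoints `s` of `e` move simultaneously to
`clip c ((1 - θ) x_s + θ x_{-s})`, where `-s` is the other endpoint; all other nodes keep
their values. -/
noncomputable def interact (G : SignedGraph V) (α β c : ℝ) (e : Sym2 V) (x : V → ℝ) : V → ℝ :=
  fun s =>
    if h : s ∈ e then
      clip c ((1 - G.weight α β e) * x s + G.weight α β e * x (Sym2.Mem.other h))
    else x s

/-- The states `x(0), x(1), …` when the pair `e t` interacts at time `t`. -/
noncomputable def trajectory (G : SignedGraph V) (α β c : ℝ) (x₀ : V → ℝ) (e : ℕ → Sym2 V) :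
    ℕ → V → ℝ
  | 0 => x₀
  | t + 1 => G.interact α β c (e t) (trajectory G α β c x₀ e t)

end SignedGraph

/-- The pairs `E 0, E 1, …` are independent random variables, each with law `p`. The finite set of
pairs carries the discrete σ-algebra. -/
structure IsRandomPairSelection {V Ω : Type*} [MeasurableSpace Ω] (p : PMF (Sym2 V))
    (P : Measure Ω) (E : ℕ → Ω → Sym2 V) : Prop where
  measurable : ∀ t, Measurable[_, ⊤] (E t)
  indep : iIndepFun (m := fun _ => ⊤) E P
  law : ∀ t e, P (E t ⁻¹' {e}) = p e

/-! Labelling `V₁` by 1 and `V₂` by -1, the two states `c • σ` and `-(c • σ)` are fixed by every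
interaction, so it suffices that the chain hits one of them almost surely. The obstruction is drift
towards consensus, measured by `spread` tending to 0. A positive edge shrinks the spread at most by
the factor `1 - 2 * α`, and a negative edge never shrinks it. In every state some negative edge
joins nodes at least half a spread apart; it is drawn with probability at least `q` and multiplies
the spread by at least `(1 + β) / 2`, or raises it to the full width `2 * c`. For small `s > 0` and
then large `β`, the function `spread ^ (-s)` therefore contracts in mean up to an additive constant
(`sum_mul_spread_rpow_le`), so its expectation stays bounded. Since `c` enters only that constant,
the threshold for `β` does not depend on it. From spread at least `δ`, a bounded number of moves
leads to a polarised state (`exists_canReach`): saturate one opposite pair, then use it to settle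
the other nodes one by one. Tightness and uniform reachability give absorption
(`ae_exists_mem_of_tight`). The spread is positive initially off a null set. -/

open scoped ENNReal

namespace SignedGraph

/-! ### Clipping. -/

section Clip

theorem clip_eq_max_min {c : ℝ} (hc : 0 < c) (z : ℝ) : clip c z = max (-c) (min c z) := by
  unfold clip
  split_ifs with h1 h2
  · rw [max_eq_left]; exact (min_le_right _ _).trans h1.le
  · rw [min_eq_left h2.le, max_eq_right (by linarith)]
  · rw [min_eq_right (not_lt.1 h2), max_eq_right (not_lt.1 h1)]

theorem clip_eq_self {c z : ℝ} (h : z ∈ Set.Icc (-c) c) : clip c z = z := by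
  unfold clip
  rw [if_neg (not_lt.2 h.1), if_neg (not_lt.2 h.2)]

theorem clip_mem_Icc {c : ℝ} (hc : 0 < c) (z : ℝ) : clip c z ∈ Set.Icc (-c) c := by
  rw [clip_eq_max_min hc]
  exact ⟨le_max_left _ _, max_le (by linarith) (min_le_left _ _)⟩

theorem min_le_clip {c : ℝ} (hc : 0 < c) (z : ℝ) : min c z ≤ clip c z := by
  rw [clip_eq_max_min hc]
  exact le_max_right _ _

theorem clip_le_max {c : ℝ} (hc : 0 < c) (z : ℝ) : clip c z ≤ max (-c) z := by
  rw [clip_eq_max_min hc]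
  exact max_le_max le_rfl (min_le_right _ _)

theorem clip_neg {c : ℝ} (hc : 0 < c) (z : ℝ) : clip c (-z) = -clip c z := by
  unfold clip
  split_ifs <;> linarith

end Clip

/-! ### Balanced labellings and the effect of one interaction. -/

variable {V : Type*}

/-- A `±1`-labelling of the nodes that realises the structural balance of a complete signed graph:
equal labels are joined by a positive edge, opposite labels by a negative one. -/
structure IsBalancing (G : SignedGraph V) (σ : V → ℝ) : Prop where
  sign : ∀ i, σ i = 1 ∨ σ i = -1
  pos : ∀ i j, i ≠ j → σ i = σ j → G.pos.Adj i j
  neg : ∀ i j, σ i = -σ j → G.neg.Adj i j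

theorem IsBalancing.neg_label {G : SignedGraph V} {σ : V → ℝ} (h : G.IsBalancing σ) :
    G.IsBalancing (-σ) where
  sign i := by rcases h.sign i with h | h <;> simp [h]
  pos i j hij hs := h.pos i j hij (by simpa using hs)
  neg i j hs := h.neg i j (by simpa [neg_eq_iff_eq_neg] using hs)

theorem IsBalancing.eq_or_eq_neg {G : SignedGraph V} {σ : V → ℝ} (h : G.IsBalancing σ) (i j : V) :
    σ i = σ j ∨ σ i = -σ j := by
  rcases h.sign i with hi | hi <;> rcases h.sign j with hj | hj <;> simp [hi, hj]

theorem IsBalancing.mul_self {G : SignedGraph V} {σ : V → ℝ} (h : G.IsBalancing σ) (i : V) :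
    σ i * σ i = 1 := by
  rcases h.sign i with hi | hi <;> simp [hi]

theorem IsBalancing.graph_adj {G : SignedGraph V} {σ : V → ℝ} (h : G.IsBalancing σ) {i j : V}
    (hij : i ≠ j) : G.graph.Adj i j := by
  rcases h.eq_or_eq_neg i j with hs | hs
  · exact Or.inl (h.pos i j hij hs)
  · exact Or.inr (h.neg i j hs)

theorem IsBalancing.ne_of_opposite {G : SignedGraph V} {σ : V → ℝ} (h : G.IsBalancing σ) {i j : V}
    (hs : σ i = -σ j) : i ≠ j := (h.neg i j hs).ne

theorem weight_of_pos (G : SignedGraph V) (α β : ℝ) {a b : V} (h : G.pos.Adj a b) :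
    G.weight α β s(a, b) = α := by
  simp [weight, h]

theorem weight_of_neg (G : SignedGraph V) (α β : ℝ) {a b : V} (h : G.neg.Adj a b) :
    G.weight α β s(a, b) = -β := by
  have : ¬ G.pos.Adj a b := fun h' =>
    (SimpleGraph.disjoint_left.1 G.disjoint) a b h' h
  simp [weight, h, this]

theorem weight_diag (G : SignedGraph V) (α β : ℝ) (a : V) : G.weight α β s(a, a) = 0 := by
  simp [weight]

theorem interact_left (G : SignedGraph V) (α β c : ℝ) (a b : V) (x : V → ℝ) :
    G.interact α β c s(a, b) x a =
      clip c ((1 - G.weight α β s(a, b)) * x a + G.weight α β s(a, b) * x b) := by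
  have h : a ∈ s(a, b) := Sym2.mem_mk_left a b
  have ho : Sym2.Mem.other h = b := Sym2.congr_right.1 (Sym2.other_spec h)
  rw [interact, dif_pos h, ho]

theorem interact_right (G : SignedGraph V) (α β c : ℝ) (a b : V) (x : V → ℝ) :
    G.interact α β c s(a, b) x b =
      clip c ((1 - G.weight α β s(a, b)) * x b + G.weight α β s(a, b) * x a) := by
  rw [Sym2.eq_swap, interact_left]

theorem interact_of_ne (G : SignedGraph V) (α β c : ℝ) {a b s : V} (ha : s ≠ a) (hb : s ≠ b)
    (x : V → ℝ) : G.interact α β c s(a, b) x s = x s := by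
  rw [interact, dif_neg (by simp [ha, hb])]

theorem interact_diag (G : SignedGraph V) (α β : ℝ) {c : ℝ} (a : V) {x : V → ℝ}
    (hx : ∀ i, x i ∈ Set.Icc (-c) c) : G.interact α β c s(a, a) x = x := by
  funext s
  by_cases h : s = a
  · subst h
    rw [interact_left, weight_diag]
    simpa using clip_eq_self (hx s)
  · exact interact_of_ne G α β c h h x

theorem interact_mem_Icc (G : SignedGraph V) (α β : ℝ) {c : ℝ} (hc : 0 < c) (e : Sym2 V)
    {x : V → ℝ} (hx : ∀ i, x i ∈ Set.Icc (-c) c) (i : V) :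
    G.interact α β c e x i ∈ Set.Icc (-c) c := by
  unfold interact
  split_ifs
  · exact clip_mem_Icc hc _
  · exact hx i

/-- The two polarised states that agree with a labelling up to a global sign. -/
def polarized (c : ℝ) (σ : V → ℝ) : Set (V → ℝ) := {c • σ, -(c • σ)}

theorem polarized_neg (c : ℝ) (σ : V → ℝ) : polarized c (-σ) = polarized c σ := by
  simp [polarized, Set.pair_comm]

section Balanced

variable {G : SignedGraph V} {σ : V → ℝ} {α β c : ℝ}

theorem IsBalancing.smul_mem_Icc (h : G.IsBalancing σ) (hc : 0 < c) (i : V) :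
    (c • σ) i ∈ Set.Icc (-c) c := by
  rcases h.sign i with hi | hi <;> simp [hi] <;> linarith

/-- A negative edge sends `c * σ a` to `(1 + 2 * β) * (c * σ a)`, which clipping returns to the
boundary. Clipping is thus what makes polarised states absorbing. -/
theorem IsBalancing.interact_smul (h : G.IsBalancing σ) (hβ : 0 < β) (hc : 0 < c) (e : Sym2 V) :
    G.interact α β c e (c • σ) = c • σ := by
  have key : ∀ a b, a ≠ b → G.interact α β c s(a, b) (c • σ) a = (c • σ) a := by
    intro a b hab
    have hm := h.smul_mem_Icc hc a
    rw [interact_left]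
    rcases h.eq_or_eq_neg a b with hs | hs
    · rw [weight_of_pos G α β (h.pos a b hab hs)]
      have : (1 - α) * (c • σ) a + α * (c • σ) b = (c • σ) a := by
        simp [← hs]; ring
      rw [this, clip_eq_self hm]
    · rw [weight_of_neg G α β (h.neg a b hs)]
      have hb : σ b = -σ a := by linarith
      have : (1 - -β) * (c • σ) a + -β * (c • σ) b = (1 + 2 * β) * (c * σ a) := by
        simp [hb]; ring
      rw [this]
      have hcb : 0 < β * c := mul_pos hβ hc
      rcases h.sign a with ha | ha
      · simp only [ha, Pi.smul_apply, smul_eq_mul, mul_one]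
        unfold clip
        rw [if_neg (by linarith), if_pos (by linarith)]
      · simp only [ha, Pi.smul_apply, smul_eq_mul]
        unfold clip
        rw [if_pos (by linarith)]
        ring
  induction e using Sym2.ind with
  | _ a b =>
    by_cases hab : a = b
    · subst hab
      exact interact_diag G α β a (h.smul_mem_Icc hc)
    funext s
    by_cases hsa : s = a
    · subst hsa; exact key s b hab
    by_cases hsb : s = b
    · subst hsb; rw [Sym2.eq_swap]; exact key s a hsa
    exact interact_of_ne G α β c hsa hsb _

theorem IsBalancing.interact_polarized (h : G.IsBalancing σ) (hβ : 0 < β) (hc : 0 < c)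
    (e : Sym2 V) {x : V → ℝ} (hx : x ∈ polarized c σ) : G.interact α β c e x = x := by
  rcases hx with rfl | hx
  · exact h.interact_smul hβ hc e
  · rw [Set.mem_singleton_iff] at hx
    rw [hx, ← smul_neg]
    exact h.neg_label.interact_smul hβ hc e

/-- An edge between nodes with opposite labels, in coordinates multiplied by the labels. -/
theorem IsBalancing.interact_opposite (h : G.IsBalancing σ) (hc : 0 < c) {a b : V}
    (hs : σ a = -σ b) (x : V → ℝ) :
    σ a * G.interact α β c s(a, b) x a =
      clip c (σ a * x a + β * (σ a * x a + σ b * x b)) := by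
  rw [interact_left, weight_of_neg G α β (h.neg a b hs)]
  have hb : σ b = -σ a := by linarith
  rcases h.sign a with ha | ha
  · rw [hb, ha]; ring_nf
  · rw [hb, ha, neg_one_mul, ← clip_neg hc]; ring_nf

/-- An edge between nodes with equal labels never leaves the box, so clipping has no effect. -/
theorem IsBalancing.interact_same (h : G.IsBalancing σ) (hα : α ∈ Set.Ioo (0 : ℝ) (1 / 2)) {a b : V}
    (hab : a ≠ b) (hs : σ a = σ b) {x : V → ℝ} (hx : ∀ i, x i ∈ Set.Icc (-c) c) :
    G.interact α β c s(a, b) x a = (1 - α) * x a + α * x b := by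
  rw [interact_left, weight_of_pos G α β (h.pos a b hab hs)]
  apply clip_eq_self
  obtain ⟨h0, h1⟩ := hα
  exact (convex_Icc (-c) c) (hx a) (hx b) (by linarith) h0.le (by ring)

theorem IsBalancing.interact_opposite_le (h : G.IsBalancing σ) (hc : 0 < c) {a b : V}
    (hs : σ a = -σ b) (x : V → ℝ) :
    min c (x a + β * (x a - x b)) ≤ G.interact α β c s(a, b) x a ∧
    G.interact α β c s(a, b) x b ≤ max (-c) (x b - β * (x a - x b)) := by
  constructor
  · rw [interact_left, weight_of_neg G α β (h.neg a b hs)]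
    convert min_le_clip hc _ using 2
    ring
  · rw [interact_right, weight_of_neg G α β (h.neg a b hs)]
    convert clip_le_max hc _ using 2
    ring

end Balanced

/-! ### How one interaction changes the spread. -/

section Spread

/-- The largest difference between two coordinates. -/
noncomputable def spread (x : V → ℝ) : ℝ := ⨆ q : V × V, (x q.1 - x q.2)

variable [Finite V]

theorem sub_le_spread (x : V → ℝ) (i j : V) : x i - x j ≤ spread x :=
  le_ciSup (f := fun q : V × V => x q.1 - x q.2) (Set.finite_range _).bddAbove (i, j)

theorem exists_sub_eq_spread [Nonempty V] (x : V → ℝ) : ∃ i j, x i - x j = spread x := by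
  obtain ⟨⟨i, j⟩, h⟩ := exists_eq_ciSup_of_finite (f := fun q : V × V => x q.1 - x q.2)
  exact ⟨i, j, h⟩

variable {G : SignedGraph V} {σ : V → ℝ} {α β c : ℝ}

/-- Some pair of nodes with opposite labels is at least half a spread apart. -/
theorem IsBalancing.exists_half_spread_le (h : G.IsBalancing σ) (h1 : ∃ i, σ i = 1)
    (h2 : ∃ i, σ i = -1) (x : V → ℝ) :
    ∃ a b, σ a = -σ b ∧ spread x / 2 ≤ x a - x b := by
  obtain ⟨u, hu⟩ := h1
  obtain ⟨v, hv⟩ := h2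
  have : Nonempty V := ⟨u⟩
  obtain ⟨i, j, hij⟩ := exists_sub_eq_spread x
  rcases h.eq_or_eq_neg i j with hs | hs
  · obtain ⟨k, hk⟩ : ∃ k, σ i = -σ k := by
      rcases h.sign i with hi | hi
      · exact ⟨v, by rw [hi, hv]; norm_num⟩
      · exact ⟨u, by rw [hi, hu]⟩
    -- The value at `k` splits the gap between `i` and `j`, so one of the two pieces is at least
    -- half of it.
    rcases le_total (spread x / 2) (x i - x k) with hle | hle
    · exact ⟨i, k, hk, hle⟩
    · exact ⟨k, j, by rw [← hs, hk, neg_neg], by linarith⟩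
  · have := sub_le_spread x i i
    exact ⟨i, j, hs, by linarith⟩

/-- Repulsion moves the upper endpoint up and the lower one down, as far as the box allows, so both
extremes of the old state are still attained or exceeded. -/
theorem IsBalancing.spread_le_interact_opposite (h : G.IsBalancing σ) (hβ : 0 < β) (hc : 0 < c)
    {a b : V} (hs : σ a = -σ b) {x : V → ℝ} (hx : ∀ i, x i ∈ Set.Icc (-c) c) :
    spread x ≤ spread (G.interact α β c s(a, b) x) := by
  wlog hab : x b ≤ x a generalizing a b
  · rw [Sym2.eq_swap]
    exact this (by linarith) (le_of_not_ge hab)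
  obtain ⟨ha, hb⟩ := h.interact_opposite_le (α := α) (β := β) hc hs x
  have : Nonempty V := ⟨a⟩
  obtain ⟨i, j, hij⟩ := exists_sub_eq_spread x
  set y := G.interact α β c s(a, b) x with hy
  have hba : 0 ≤ β * (x a - x b) := mul_nonneg hβ.le (by linarith)
  have hya : x a ≤ y a := (le_min (hx a).2 (by linarith)).trans ha
  have hyb : y b ≤ x b := hb.trans (max_le (hx b).1 (by linarith))
  have hyo : ∀ s, s ≠ a → s ≠ b → y s = x s := fun s h1 h2 => interact_of_ne G α β c h1 h2 x
  have hup : ∃ i', x i ≤ y i' := by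
    by_cases hia : i = a
    · exact ⟨a, hia ▸ hya⟩
    by_cases hib : i = b
    · exact ⟨a, by rw [hib]; linarith⟩
    exact ⟨i, (hyo i hia hib).ge⟩
  have hdown : ∃ j', y j' ≤ x j := by
    by_cases hjb : j = b
    · exact ⟨b, hjb ▸ hyb⟩
    by_cases hja : j = a
    · exact ⟨b, by rw [hja]; linarith⟩
    exact ⟨j, (hyo j hja hjb).le⟩
  obtain ⟨i', hi'⟩ := hup
  obtain ⟨j', hj'⟩ := hdown
  have := sub_le_spread y i' j'
  linarith

/-- If both endpoints saturate, the gap is `2 * c`. The factor is `1 + β` and not `1 + 2 * β`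
because one endpoint may be clipped and contribute no usable push. -/
theorem IsBalancing.min_le_spread_interact (h : G.IsBalancing σ) (hβ : 0 < β) (hc : 0 < c)
    {a b : V} (hs : σ a = -σ b) {x : V → ℝ} (hx : ∀ i, x i ∈ Set.Icc (-c) c) (hab : x b ≤ x a) :
    min (2 * c) ((1 + β) * (x a - x b)) ≤ spread (G.interact α β c s(a, b) x) := by
  obtain ⟨ha, hb⟩ := h.interact_opposite_le (α := α) (β := β) hc hs x
  set y := G.interact α β c s(a, b) x with hy
  have hy := sub_le_spread y a b
  have hba : 0 ≤ β * (x a - x b) := mul_nonneg hβ.le (by linarith)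
  have h1 := (hx a).2
  have h2 := (hx b).1
  rcases min_le_iff.1 ha with ha | ha <;> rcases le_max_iff.1 hb with hb | hb
  · exact (min_le_left _ _).trans (by linarith)
  all_goals exact (min_le_right _ _).trans (by linarith)

/-- Averaging is invertible because `α < 1 / 2`. Writing old values through new ones bounds each old
gap; the extreme case is the gap between the two endpoints themselves, which shrinks exactly by `1 -
2 * α`. -/
theorem IsBalancing.spread_interact_same (h : G.IsBalancing σ) (hα : α ∈ Set.Ioo (0 : ℝ) (1 / 2))
    {a b : V} (hab : a ≠ b) (hs : σ a = σ b) {x : V → ℝ} (hx : ∀ i, x i ∈ Set.Icc (-c) c) :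
    (1 - 2 * α) * spread x ≤ spread (G.interact α β c s(a, b) x) := by
  have : Nonempty V := ⟨a⟩
  obtain ⟨i, j, hij⟩ := exists_sub_eq_spread x
  have ha := h.interact_same (β := β) hα hab hs hx
  have hb := h.interact_same (β := β) hα hab.symm hs.symm hx
  rw [Sym2.eq_swap] at hb
  have hyo : ∀ s, s ≠ a → s ≠ b → G.interact α β c s(a, b) x s = x s :=
    fun s h1 h2 => interact_of_ne G α β c h1 h2 x
  set y := G.interact α β c s(a, b) x with hy
  obtain ⟨h0, h1⟩ := hα
  have hpos : 0 ≤ spread y := by have := sub_le_spread y a a; linarith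
  have hD := sub_le_spread y
  have scale : ∀ u v, (1 - 2 * α) * (y u - y v) ≤ (1 - 2 * α) * spread y := fun u v =>
    mul_le_mul_of_nonneg_left (hD u v) (by linarith)
  have scale' : ∀ u v, α * (y u - y v) ≤ α * spread y := fun u v =>
    mul_le_mul_of_nonneg_left (hD u v) h0.le
  have hαD : 0 ≤ α * spread y := mul_nonneg h0.le hpos
  have hαD' : 2 * α * spread y ≤ spread y := by nlinarith
  have xa : (1 - 2 * α) * x a = (1 - 2 * α) * y a + α * (y a - y b) := by rw [ha, hb]; ring
  have xb : (1 - 2 * α) * x b = (1 - 2 * α) * y b + α * (y b - y a) := by rw [ha, hb]; ring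
  rw [← hij]
  have hab1 := hD a b
  have hab2 := hD b a
  have e1 : y a - y b = (1 - 2 * α) * (x a - x b) := by rw [ha, hb]; ring
  have s1 := scale' a b
  have s2 := scale' b a
  have s3 := scale i j
  have s4 := scale a j
  have s5 := scale b j
  have s6 := scale i a
  have s7 := scale i b
  by_cases hia : i = a
  · by_cases hja : j = a
    · rw [hia, hja]; linarith
    by_cases hjb : j = b
    · rw [hia, hjb]; linarith
    rw [hia, ← hyo j hja hjb]; linarith
  by_cases hib : i = b
  · by_cases hja : j = a
    · rw [hib, hja]; linarith
    by_cases hjb : j = b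
    · rw [hib, hjb]; linarith
    rw [hib, ← hyo j hja hjb]; linarith
  by_cases hja : j = a
  · rw [hja, ← hyo i hia hib]; linarith
  by_cases hjb : j = b
  · rw [hjb, ← hyo i hia hib]; linarith
  rw [← hyo i hia hib, ← hyo j hja hjb]; linarith

theorem IsBalancing.spread_interact_ge (h : G.IsBalancing σ) (hα : α ∈ Set.Ioo (0 : ℝ) (1 / 2))
    (hβ : 0 < β) (hc : 0 < c) (e : Sym2 V) {x : V → ℝ} (hx : ∀ i, x i ∈ Set.Icc (-c) c) :
    (1 - 2 * α) * spread x ≤ spread (G.interact α β c e x) := by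
  induction e using Sym2.ind with
  | _ a b =>
    have h0 : 0 ≤ spread x := by have := sub_le_spread x a a; linarith
    have h1 : (1 - 2 * α) * spread x ≤ spread x := by nlinarith [hα.1]
    by_cases hab : a = b
    · subst hab
      rwa [interact_diag G α β a hx]
    rcases h.eq_or_eq_neg a b with hs | hs
    · exact h.spread_interact_same hα hab hs hx
    · exact h1.trans (h.spread_le_interact_opposite hβ hc hs hx)

end Spread

end SignedGraph

/-! ### Reachability by a bounded number of moves. -/

/-- From `x`, the maps `F e` with `e ∈ I` lead into `A` in at most `n` steps. -/
def CanReach {ι S : Type*} (F : ι → S → S) (I : Set ι) (A : Set S) : ℕ → S → Prop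
  | 0, x => x ∈ A
  | n + 1, x => x ∈ A ∨ ∃ e ∈ I, CanReach F I A n (F e x)

namespace CanReach

variable {ι S : Type*} {F : ι → S → S} {I : Set ι} {A : Set S}

theorem of_mem {x : S} (hx : x ∈ A) : ∀ n, CanReach F I A n x
  | 0 => hx
  | _ + 1 => Or.inl hx

theorem succ {n : ℕ} : ∀ {x : S}, CanReach F I A n x → CanReach F I A (n + 1) x := by
  induction n with
  | zero => exact fun h => Or.inl h
  | succ n ih =>
    rintro x (h | ⟨e, he, h⟩)
    · exact Or.inl h
    · exact Or.inr ⟨e, he, ih h⟩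

theorem mono {n m : ℕ} (hnm : n ≤ m) {x : S} (h : CanReach F I A n x) : CanReach F I A m x := by
  induction hnm with
  | refl => exact h
  | step _ ih => exact ih.succ

theorem of_step {n : ℕ} {x : S} {e : ι} (he : e ∈ I) (h : CanReach F I A n (F e x)) :
    CanReach F I A (n + 1) x := Or.inr ⟨e, he, h⟩

theorem of_iterate {n : ℕ} {e : ι} (he : e ∈ I) (k : ℕ) :
    ∀ {x : S}, CanReach F I A n ((F e)^[k] x) → CanReach F I A (n + k) x := by
  induction k with
  | zero => exact fun h => h
  | succ k ih =>
    intro x h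
    rw [Function.iterate_succ_apply] at h
    exact of_step he (ih h)

end CanReach

/-! ### Steering to a polarised state. -/

namespace SignedGraph

variable {V : Type*} {G : SignedGraph V} {σ : V → ℝ} {α β c : ℝ}

theorem iterate_interact_mem_Icc (G : SignedGraph V) (α β : ℝ) (hc : 0 < c) (e : Sym2 V)
    {x : V → ℝ} (hx : ∀ i, x i ∈ Set.Icc (-c) c) (n : ℕ) :
    ∀ i, (G.interact α β c e)^[n] x i ∈ Set.Icc (-c) c := by
  induction n with
  | zero => exact hx
  | succ n ih =>
    rw [Function.iterate_succ_apply']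
    exact interact_mem_Icc G α β hc e ih

theorem iterate_interact_of_ne (G : SignedGraph V) (α β c : ℝ) {a b s : V} (ha : s ≠ a)
    (hb : s ≠ b) (x : V → ℝ) (n : ℕ) : (G.interact α β c s(a, b))^[n] x s = x s := by
  induction n with
  | zero => rfl
  | succ n ih => rw [Function.iterate_succ_apply', interact_of_ne G α β c ha hb, ih]

theorem IsBalancing.mul_mem_Icc (h : G.IsBalancing σ) {x : V → ℝ}
    (hx : ∀ i, x i ∈ Set.Icc (-c) c) (i : V) : σ i * x i ∈ Set.Icc (-c) c := by
  obtain ⟨h1, h2⟩ := hx i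
  rcases h.sign i with hi | hi <;> rw [hi] <;> constructor <;> linarith

theorem IsBalancing.eq_smul_of_mul_eq (h : G.IsBalancing σ) {i : V} {y : ℝ} (hy : σ i * y = c) :
    y = c * σ i := by
  rw [← hy, mul_right_comm, h.mul_self, one_mul]

/-- In coordinates multiplied by the labels, both endpoints gain `β` times their sum and are then
cut at `c`. The sum never decreases, so each step gains at least `β * η` until saturation, starting
at worst from `-c`. -/
theorem IsBalancing.iterate_interact_opposite_ge (h : G.IsBalancing σ) (hβ : 0 < β) (hc : 0 < c)
    {η : ℝ} (hη : 0 < η) {a b : V} (hs : σ a = -σ b) {x : V → ℝ}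
    (hx : ∀ i, x i ∈ Set.Icc (-c) c) (hab : η ≤ σ a * x a + σ b * x b) (n : ℕ) :
    η ≤ σ a * (G.interact α β c s(a, b))^[n] x a + σ b * (G.interact α β c s(a, b))^[n] x b ∧
    min c (-c + n * (β * η)) ≤ σ a * (G.interact α β c s(a, b))^[n] x a ∧
    min c (-c + n * (β * η)) ≤ σ b * (G.interact α β c s(a, b))^[n] x b := by
  induction n with
  | zero =>
    refine ⟨hab, ?_, ?_⟩ <;> refine (min_le_right _ _).trans ?_ <;> simp only [Nat.cast_zero,
      zero_mul, add_zero, Function.iterate_zero, id]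
    exacts [(h.mul_mem_Icc hx a).1, (h.mul_mem_Icc hx b).1]
  | succ n ih =>
    obtain ⟨i0, i1, i2⟩ := ih
    rw [Function.iterate_succ_apply']
    have hz := iterate_interact_mem_Icc G α β hc s(a, b) hx n
    set z := (G.interact α β c s(a, b))^[n] x with hzdef
    have ea := h.interact_opposite (α := α) (β := β) hc hs z
    have eb := h.interact_opposite (α := α) (β := β) hc (a := b) (b := a) (by linarith) z
    rw [Sym2.eq_swap] at eb
    rw [ea, eb]
    have hza := h.mul_mem_Icc hz a
    have hzb := h.mul_mem_Icc hz b
    have hpos : 0 < β * η := mul_pos hβ hη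
    have hgain : β * η ≤ β * (σ a * z a + σ b * z b) := mul_le_mul_of_nonneg_left i0 hβ.le
    have hgain' : β * η ≤ β * (σ b * z b + σ a * z a) := by rwa [add_comm (σ b * z b)]
    have hcase : ∀ u g : ℝ, u ≤ c → β * η ≤ g → min c (-c + n * (β * η)) ≤ u →
        u ≤ clip c (u + g) ∧ min c (-c + (n + 1 : ℕ) * (β * η)) ≤ clip c (u + g) := by
      intro u g hu hg hmin
      have hcl := min_le_clip hc (u + g)
      refine ⟨(le_min hu (by linarith)).trans hcl, le_trans (le_min (min_le_left _ _) ?_) hcl⟩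
      push_cast
      rcases min_le_iff.1 hmin with hm | hm
      · exact (min_le_left _ _).trans (by linarith)
      · exact (min_le_right _ _).trans (by linarith)
    obtain ⟨a1, a2⟩ := hcase _ _ hza.2 hgain i1
    obtain ⟨b1, b2⟩ := hcase _ _ hzb.2 hgain' i2
    exact ⟨by linarith, a2, b2⟩

/-- Repeating an edge between nodes with opposite labels drives both endpoints to the boundary. -/
theorem IsBalancing.iterate_interact_opposite_eq (h : G.IsBalancing σ) (hβ : 0 < β) (hc : 0 < c)
    {η : ℝ} (hη : 0 < η) {a b : V} (hs : σ a = -σ b) {x : V → ℝ}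
    (hx : ∀ i, x i ∈ Set.Icc (-c) c) (hab : η ≤ σ a * x a + σ b * x b) {n : ℕ}
    (hn : 2 * c ≤ n * (β * η)) :
    (G.interact α β c s(a, b))^[n] x a = c * σ a ∧
      (G.interact α β c s(a, b))^[n] x b = c * σ b := by
  obtain ⟨-, h1, h2⟩ := h.iterate_interact_opposite_ge (α := α) hβ hc hη hs hx hab n
  rw [min_eq_left (by linarith)] at h1 h2
  have hz := iterate_interact_mem_Icc G α β hc s(a, b) hx n
  exact ⟨h.eq_smul_of_mul_eq (le_antisymm (h.mul_mem_Icc hz a).2 h1),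
    h.eq_smul_of_mul_eq (le_antisymm (h.mul_mem_Icc hz b).2 h2)⟩

/-- If two nodes `a`, `b` with opposite labels sit at the boundary, a third node `k` on the side
of `a` can be brought to the boundary as well, moving nobody else in the end. -/
theorem IsBalancing.canReach_of_settle (h : G.IsBalancing σ) (hα : α ∈ Set.Ioo (0 : ℝ) (1 / 2))
    (hβ : 0 < β) (hc : 0 < c) {A : Set (V → ℝ)} {m n : ℕ} (hm : 2 * c ≤ m * (β * (2 * α * c)))
    {a b k : V} (hs : σ a = -σ b) (hk : σ k = σ a) (hka : k ≠ a) {x : V → ℝ}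
    (hx : ∀ i, x i ∈ Set.Icc (-c) c) (hxa : x a = c * σ a) (hxb : x b = c * σ b)
    (hA : ∀ y : V → ℝ, (∀ i, y i ∈ Set.Icc (-c) c) → y k = c * σ k →
      (∀ i, i ≠ k → y i = x i) → CanReach (G.interact α β c) G.graph.edgeSet A n y) :
    CanReach (G.interact α β c) G.graph.edgeSet A (n + m + m + 1) x := by
  have hkb : k ≠ b := h.ne_of_opposite (by rw [hk, hs])
  have hab : a ≠ b := h.ne_of_opposite hs
  have hη : 0 < 2 * α * c := mul_pos (mul_pos two_pos hα.1) hc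
  have edge : ∀ {u v : V}, u ≠ v → s(u, v) ∈ G.graph.edgeSet := fun huv =>
    (SimpleGraph.mem_edgeSet _).2 (h.graph_adj huv)
  have hαc : 2 * α * c ≤ c := by nlinarith [hα.2]
  have hsa := h.mul_self a
  have hsb := h.mul_self b
  -- One averaging with `a` lifts `σ k * x k` from at worst `-c` to at least `-c + 2 * α * c`, so
  -- that its sum with the saturated `b` is at least `2 * α * c`; repeating `s(k, b)` then settles
  -- `k`.
  refine CanReach.of_step (edge hka) ?_
  have h1k := h.interact_same (β := β) hα hka hk hx
  have h1a := h.interact_same (β := β) hα hka.symm hk.symm hx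
  rw [Sym2.eq_swap] at h1a
  have h1o : ∀ i, i ≠ k → i ≠ a → G.interact α β c s(k, a) x i = x i :=
    fun i h1 h2 => interact_of_ne G α β c h1 h2 x
  have h1box := interact_mem_Icc G α β hc s(k, a) hx
  set x1 := G.interact α β c s(k, a) x
  have hxk := h.mul_mem_Icc hx k
  have e1 : 2 * α * c ≤ σ k * x1 k + σ b * x1 b := by
    rw [h1k, h1o b hkb.symm hab.symm, hxa, hxb]
    have : σ k * ((1 - α) * x k + α * (c * σ a)) + σ b * (c * σ b) =
        (1 - α) * (σ k * x k) + α * c + c := by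
      linear_combination (α * c * σ a) * hk + α * c * hsa + c * hsb
    rw [this]
    nlinarith [hxk.1, hα.1, hα.2]
  refine CanReach.of_iterate (edge hkb) m ?_
  obtain ⟨h2k, h2b⟩ := h.iterate_interact_opposite_eq (α := α) hβ hc hη (hk.trans hs) h1box e1 hm
  have h2o : ∀ i, i ≠ k → i ≠ b → (G.interact α β c s(k, b))^[m] x1 i = x1 i :=
    fun i h1 h2 => iterate_interact_of_ne G α β c h1 h2 x1 m
  have h2box := iterate_interact_mem_Icc G α β hc s(k, b) h1box m
  set x2 := (G.interact α β c s(k, b))^[m] x1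
  have e2 : 2 * α * c ≤ σ a * x2 a + σ b * x2 b := by
    rw [h2o a hka.symm hab, h2b, h1a, hxa]
    have : σ a * ((1 - α) * (c * σ a) + α * x k) + σ b * (c * σ b) =
        (1 - α) * c + α * (σ k * x k) + c := by
      linear_combination (-α * x k) * hk + (1 - α) * c * hsa + c * hsb
    rw [this]
    nlinarith [hxk.1, hα.1, hα.2]
  -- The averaging displaced `a`; repeating `s(a, b)` restores it. Here `α < 1 / 2` gives the same
  -- lower bound `2 * α * c`.
  refine CanReach.of_iterate (edge hab) m ?_
  obtain ⟨h3a, h3b⟩ := h.iterate_interact_opposite_eq (α := α) hβ hc hη hs h2box e2 hm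
  have h3o : ∀ i, i ≠ a → i ≠ b → (G.interact α β c s(a, b))^[m] x2 i = x2 i :=
    fun i h1 h2 => iterate_interact_of_ne G α β c h1 h2 x2 m
  refine hA _ (iterate_interact_mem_Icc G α β hc s(a, b) h2box m) ?_ ?_
  · rw [h3o k hka hkb, h2k]
  · intro i hik
    by_cases hia : i = a
    · rw [hia, h3a, hxa]
    by_cases hib : i = b
    · rw [hib, h3b, hxb]
    rw [h3o i hia hib, h2o i hik hib, h1o i hik hia]

/-- Induction on the set of possibly unsettled nodes: each costs at most `2 * m + 1` moves, and the
saturated pair `a`, `b` is available again afterwards. -/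
theorem IsBalancing.canReach_of_unsettled (h : G.IsBalancing σ)
    (hα : α ∈ Set.Ioo (0 : ℝ) (1 / 2)) (hβ : 0 < β) (hc : 0 < c) {m : ℕ}
    (hm : 2 * c ≤ m * (β * (2 * α * c))) {a b : V} (hs : σ a = -σ b) (S : Finset V) :
    ∀ x : V → ℝ, (∀ i, x i ∈ Set.Icc (-c) c) → x a = c * σ a → x b = c * σ b →
      (∀ i, i ∉ S → x i = c * σ i) →
      CanReach (G.interact α β c) G.graph.edgeSet (polarized c σ) (S.card * (m + m + 1)) x := by
  classical
  induction S using Finset.induction_on with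
  | empty =>
    intro x _ _ _ ho
    have hmem : x ∈ polarized c σ := Or.inl (funext fun i => ho i (Finset.notMem_empty i))
    exact CanReach.of_mem hmem _
  | insert k S hkS ih =>
    intro x hx hxa hxb ho
    rw [Finset.card_insert_of_notMem hkS, add_mul, one_mul, ← add_assoc, ← add_assoc]
    have step : x k ≠ c * σ k → ∀ y : V → ℝ, (∀ i, y i ∈ Set.Icc (-c) c) → y k = c * σ k →
        (∀ i, i ≠ k → y i = x i) →
        CanReach (G.interact α β c) G.graph.edgeSet (polarized c σ) (S.card * (m + m + 1)) y := by
      intro hxk y hy hyk hyo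
      have hka : a ≠ k := by rintro rfl; exact hxk hxa
      have hkb : b ≠ k := by rintro rfl; exact hxk hxb
      refine ih y hy ((hyo a hka).trans hxa) ((hyo b hkb).trans hxb) fun i hi => ?_
      by_cases hik : i = k
      · rw [hik, hyk]
      · rw [hyo i hik]
        exact ho i (by simp [hik, hi])
    by_cases hxk : x k = c * σ k
    · refine (ih x hx hxa hxb fun i hi => ?_).mono (by omega)
      by_cases hik : i = k
      · rw [hik, hxk]
      · exact ho i (by simp [hik, hi])
    rcases h.eq_or_eq_neg k a with hk | hk
    · exact h.canReach_of_settle hα hβ hc hm hs hk (by rintro rfl; exact hxk hxa) hx hxa hxb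
        (step hxk)
    · exact h.canReach_of_settle hα hβ hc hm (a := b) (b := a) (by linarith) (by linarith)
        (by rintro rfl; exact hxk hxb) hx hxb hxa (step hxk)

/-- A polarised state can be reached within a number of steps that depends only on a lower bound
for the spread. -/
theorem IsBalancing.exists_canReach [Finite V] (h : G.IsBalancing σ) (h1 : ∃ i, σ i = 1)
    (h2 : ∃ i, σ i = -1) (hα : α ∈ Set.Ioo (0 : ℝ) (1 / 2)) (hβ : 0 < β) (hc : 0 < c)
    {δ : ℝ} (hδ : 0 < δ) :
    ∃ n, ∀ x : V → ℝ, (∀ i, x i ∈ Set.Icc (-c) c) → δ ≤ spread x →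
      CanReach (G.interact α β c) G.graph.edgeSet (polarized c σ) n x := by
  have := Fintype.ofFinite V
  have hη : 0 < 2 * α * c := mul_pos (mul_pos two_pos hα.1) hc
  obtain ⟨m, hm⟩ := exists_nat_ge (2 * c / (β * (2 * α * c)))
  obtain ⟨k, hk⟩ := exists_nat_ge (2 * c / (β * (δ / 2)))
  rw [div_le_iff₀ (by positivity)] at hm hk
  refine ⟨(Finset.univ : Finset V).card * (m + m + 1) + k, fun x hx hxδ => ?_⟩
  obtain ⟨a, b, hs, hab⟩ := h.exists_half_spread_le h1 h2 x
  have edge : s(a, b) ∈ G.graph.edgeSet :=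
    (SimpleGraph.mem_edgeSet _).2 (h.graph_adj (h.ne_of_opposite hs))
  -- The sign of the labelling is chosen so that the larger of `x a`, `x b` carries label 1. Both
  -- signs have the same polarised set.
  have main : ∀ τ : V → ℝ, G.IsBalancing τ → τ a = -τ b → δ / 2 ≤ τ a * x a + τ b * x b →
      CanReach (G.interact α β c) G.graph.edgeSet (polarized c τ)
        ((Finset.univ : Finset V).card * (m + m + 1) + k) x := by
    intro τ hτ hsτ hge
    obtain ⟨ha, hb⟩ :=
      hτ.iterate_interact_opposite_eq (α := α) hβ hc (by positivity) hsτ hx hge hk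
    exact CanReach.of_iterate edge k (hτ.canReach_of_unsettled hα hβ hc hm hsτ Finset.univ _
      (iterate_interact_mem_Icc G α β hc _ hx k) ha hb (by simp))
  rcases h.sign a with ha | ha
  · have hb : σ b = -1 := by linarith
    exact main σ h hs (by rw [ha, hb]; linarith)
  · have hb : σ b = 1 := by linarith
    rw [← polarized_neg]
    exact main (-σ) h.neg_label (by simp [ha, hb]) (by simp [ha, hb]; linarith)

end SignedGraph

/-! ### Absorption of randomly iterated maps. -/

section RandomIteration

variable {ι S Ω : Type*} {E : ℕ → Ω → ι} {F : ι → S → S} {X : ℕ → Ω → S} {x₀ : S}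

/-- Dependence on finitely many earlier choices yields both measurability, with no σ-algebra on `S`,
and independence of the state from the next choice. -/
theorem exists_eq_of_history (h0 : ∀ ω, X 0 ω = x₀)
    (hX : ∀ t ω, X (t + 1) ω = F (E t ω) (X t ω)) (t : ℕ) :
    ∃ g : (Finset.range t → ι) → S, ∀ ω, X t ω = g fun i => E i ω := by
  induction t with
  | zero => exact ⟨fun _ => x₀, h0⟩
  | succ t ih =>
    obtain ⟨g, hg⟩ := ih
    refine ⟨fun e => F (e ⟨t, by simp⟩)
      (g fun i => e ⟨i, Finset.mem_range.2 ((Finset.mem_range.1 i.2).trans t.lt_succ_self)⟩),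
      fun ω => ?_⟩
    rw [hX, hg]

variable [Fintype ι] {w : ι → ℝ≥0∞}

/-- The transition operator of the Markov chain that applies `F e` with probability `w e`. -/
noncomputable def transition (w : ι → ℝ≥0∞) (F : ι → S → S) (f : S → ℝ≥0∞) (x : S) : ℝ≥0∞ :=
  ∑ e, w e * f (F e x)

/-- From a state from which `A` can be reached in `n` steps, the chain is in the absorbing set `A`
after `n` steps with probability at least `q ^ n`. -/
theorem pow_le_transition_iterate {A : Set S} {q : ℝ≥0∞} (hw : ∑ e, w e = 1) (hq : q ≤ 1)
    {I : Set ι} (hI : ∀ e ∈ I, q ≤ w e) (hA : ∀ e, ∀ x ∈ A, F e x ∈ A) (n : ℕ) :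
    ∀ x, (x ∈ A → (transition w F)^[n] (A.indicator 1) x = 1) ∧
      (CanReach F I A n x → q ^ n ≤ (transition w F)^[n] (A.indicator 1) x) := by
  induction n with
  | zero =>
    intro x
    have : x ∈ A → A.indicator (1 : S → ℝ≥0∞) x = 1 := fun hx => by simp [hx]
    exact ⟨this, fun hx => by simpa using (this hx).ge⟩
  | succ n ih =>
    intro x
    rw [Function.iterate_succ_apply']
    have hone : x ∈ A → transition w F ((transition w F)^[n] (A.indicator 1)) x = 1 := by
      intro hx
      rw [transition, ← hw]
      refine Finset.sum_congr rfl fun e _ => ?_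
      rw [(ih _).1 (hA e x hx), mul_one]
    refine ⟨hone, ?_⟩
    rintro (hx | ⟨e, he, hx⟩)
    · rw [hone hx]
      exact pow_le_one₀ zero_le hq
    · rw [pow_succ']
      exact (mul_le_mul' (hI e he) ((ih _).2 hx)).trans
        (Finset.single_le_sum (f := fun e => w e * (transition w F)^[n] (A.indicator 1) (F e x))
          (fun _ _ => zero_le) (Finset.mem_univ e))

variable [MeasurableSpace ι] [DiscreteMeasurableSpace ι] [MeasurableSpace Ω] {P : Measure Ω}

theorem measurable_comp_history (hE : ∀ t, Measurable (E t)) (h0 : ∀ ω, X 0 ω = x₀)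
    (hX : ∀ t ω, X (t + 1) ω = F (E t ω) (X t ω)) (t : ℕ) {β : Type*} [MeasurableSpace β]
    (f : S → β) : Measurable fun ω => f (X t ω) := by
  obtain ⟨g, hg⟩ := exists_eq_of_history h0 hX t
  simp_rw [hg]
  exact (Measurable.of_discrete (f := fun e => f (g e))).comp
    (measurable_pi_lambda _ fun i => hE i)

/-- This is the Markov property in mean: split over the value of `E t`, which is independent of `X
t`. -/
theorem lintegral_succ_eq_transition (hE : ∀ t, Measurable (E t)) (hind : iIndepFun E P)
    (hlaw : ∀ t e, P (E t ⁻¹' {e}) = w e) (h0 : ∀ ω, X 0 ω = x₀)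
    (hX : ∀ t ω, X (t + 1) ω = F (E t ω) (X t ω)) (t : ℕ) (f : S → ℝ≥0∞) :
    ∫⁻ ω, f (X (t + 1) ω) ∂P = ∫⁻ ω, transition w F f (X t ω) ∂P := by
  classical
  obtain ⟨g, hg⟩ := exists_eq_of_history h0 hX t
  have hmeas := fun e : ι => measurable_comp_history hE h0 hX t fun x => f (F e x)
  have hmI : ∀ e, Measurable fun ω => Set.indicator {e} (1 : ι → ℝ≥0∞) (E t ω) := fun e =>
    (Measurable.of_discrete (f := Set.indicator {e} (1 : ι → ℝ≥0∞))).comp (hE t)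
  have split : ∀ ω, f (X (t + 1) ω) =
      ∑ e, Set.indicator {e} (1 : ι → ℝ≥0∞) (E t ω) * f (F e (X t ω)) := by
    intro ω
    rw [Finset.sum_eq_single (E t ω), hX]
    · simp
    · intro e _ he
      simp [Set.indicator, he.symm]
    · simp
  have hI := hind.indepFun_finset (Finset.range t) {t} (by simp) hE
  simp_rw [split, transition]
  have hmul : ∀ e, Measurable fun ω =>
      Set.indicator {e} (1 : ι → ℝ≥0∞) (E t ω) * f (F e (X t ω)) := fun e => (hmI e).mul (hmeas e)
  rw [lintegral_finsetSum _ fun e _ => hmul e,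
    lintegral_finsetSum _ fun e _ => (hmeas e).const_mul _]
  refine Finset.sum_congr rfl fun e _ => ?_
  have hIe : IndepFun (fun ω => Set.indicator {e} (1 : ι → ℝ≥0∞) (E t ω))
      (fun ω => f (F e (X t ω))) P := by
    simp_rw [hg]
    exact (hI.comp (φ := fun y => f (F e (g y)))
      (ψ := fun y => Set.indicator {e} (1 : ι → ℝ≥0∞) (y ⟨t, by simp⟩))
      Measurable.of_discrete Measurable.of_discrete).symm
  have hprod := lintegral_mul_eq_lintegral_mul_lintegral_of_indepFun (hmI e) (hmeas e) hIe
  simp only [Pi.mul_apply] at hprod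
  rw [hprod, lintegral_const_mul _ (hmeas e)]
  congr 1
  have : (fun ω => Set.indicator {e} (1 : ι → ℝ≥0∞) (E t ω)) =
      Set.indicator (E t ⁻¹' {e}) 1 := by
    ext ω; simp [Set.indicator]
  rw [this, lintegral_indicator_one (hE t (MeasurableSet.singleton e)), hlaw]

theorem lintegral_add_eq_transition_iterate (hE : ∀ t, Measurable (E t)) (hind : iIndepFun E P)
    (hlaw : ∀ t e, P (E t ⁻¹' {e}) = w e) (h0 : ∀ ω, X 0 ω = x₀)
    (hX : ∀ t ω, X (t + 1) ω = F (E t ω) (X t ω)) (t n : ℕ) (f : S → ℝ≥0∞) :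
    ∫⁻ ω, f (X (t + n) ω) ∂P = ∫⁻ ω, (transition w F)^[n] f (X t ω) ∂P := by
  induction n generalizing f with
  | zero => rfl
  | succ n ih =>
    rw [← add_assoc, lintegral_succ_eq_transition hE hind hlaw h0 hX, ih,
      Function.iterate_succ_apply]

/-- A chain that is tight, in the sense that the expectation of `f` stays bounded, and reaches
the absorbing set `A` from each sublevel set of `f` within a bounded number of steps, is
absorbed almost surely. -/
theorem ae_exists_mem_of_tight [IsProbabilityMeasure P] (hE : ∀ t, Measurable (E t))
    (hind : iIndepFun E P) (hlaw : ∀ t e, P (E t ⁻¹' {e}) = w e) (hw : ∑ e, w e = 1)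
    (h0 : ∀ ω, X 0 ω = x₀) (hX : ∀ t ω, X (t + 1) ω = F (E t ω) (X t ω))
    {A : Set S} {q : ℝ≥0∞} (hq0 : q ≠ 0) (hq : q ≤ 1) {I : Set ι} (hI : ∀ e ∈ I, q ≤ w e)
    (hA : ∀ e, ∀ x ∈ A, F e x ∈ A) {D : Set S} (hD : ∀ t ω, X t ω ∈ D)
    {f : S → ℝ≥0∞} {M : ℝ≥0∞} (hM : M ≠ ∞) (hf : ∀ t, ∫⁻ ω, f (X t ω) ∂P ≤ M)
    (hreach : ∀ R : ℝ≥0∞, R ≠ ∞ → ∃ n, ∀ x ∈ D, f x < R → CanReach F I A n x) :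
    ∀ᵐ ω ∂P, ∃ t, X t ω ∈ A := by
  have hset : ∀ t (B : Set S), MeasurableSet {ω | X t ω ∈ B} := fun t B => by
    simpa using measurable_comp_history hE h0 hX t (fun x => x ∈ B) (MeasurableSet.singleton True)
  have hlin : ∀ t (B : Set S), ∫⁻ ω, B.indicator (1 : S → ℝ≥0∞) (X t ω) ∂P = P {ω | X t ω ∈ B} := by
    intro t B
    rw [← lintegral_indicator_one (hset t B)]
    rfl
  set m : ℕ → ℝ := fun t => P.real {ω | X t ω ∈ A} with hm
  have hmono : Monotone m := by
    refine monotone_nat_of_le_succ fun t => measureReal_mono fun ω hω => ?_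
    simp only [Set.mem_ofPred_eq, hX] at hω ⊢
    exact hA _ _ hω
  have hbdd : BddAbove (Set.range m) := ⟨1, by rintro _ ⟨t, rfl⟩; exact measureReal_le_one⟩
  have hlim := tendsto_atTop_ciSup hmono hbdd
  have hle1 : ∀ t, m t ≤ P.real {ω | ∃ t, X t ω ∈ A} := fun t =>
    measureReal_mono fun ω hω => ⟨t, hω⟩
  have hqtop : q ≠ ∞ := ne_top_of_le_ne_top ENNReal.one_ne_top hq
  -- By Markov's inequality, at each time `f < R` fails with probability at most `M / R`. The
  -- unabsorbed mass below `R` loses a fixed fraction `q ^ n` in `n` steps; as the absorbed mass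
  -- converges, that gain tends to 0. Since `n` depends on `R`, the limit in `t` is taken before `R`
  -- grows.
  have step : ∀ R : ℝ, 0 < R → 1 - M.toReal / R ≤ ⨆ t, m t := by
    intro R hR
    obtain ⟨n, hn⟩ := hreach (ENNReal.ofReal R) ENNReal.ofReal_ne_top
    have hstep : ∀ t, m t + q.toReal ^ n * (1 - m t - M.toReal / R) ≤ m (t + n) := by
      intro t
      set B : Set S := {x | x ∉ A ∧ f x < ENNReal.ofReal R} with hB
      have hmarkov : P.real {ω | ENNReal.ofReal R ≤ f (X t ω)} ≤ M.toReal / R := by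
        have hmk := mul_meas_ge_le_lintegral (μ := P) (measurable_comp_history hE h0 hX t f)
          (ENNReal.ofReal R)
        have hmk' := ENNReal.toReal_mono hM (hmk.trans (hf t))
        rw [ENNReal.toReal_mul, ENNReal.toReal_ofReal hR.le] at hmk'
        rw [le_div_iff₀ hR, mul_comm]
        exact hmk'
      have hcover : 1 ≤ m t + P.real {ω | X t ω ∈ B} + M.toReal / R := by
        have hu : (Set.univ : Set Ω) ⊆ ({ω | X t ω ∈ A} ∪ {ω | X t ω ∈ B}) ∪
            {ω | ENNReal.ofReal R ≤ f (X t ω)} := by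
          intro ω _
          by_cases hωA : X t ω ∈ A
          · exact Or.inl (Or.inl hωA)
          rcases lt_or_ge (f (X t ω)) (ENNReal.ofReal R) with hlt | hge
          · exact Or.inl (Or.inr ⟨hωA, hlt⟩)
          · exact Or.inr hge
        have h1 := measureReal_mono (μ := P) hu
        rw [probReal_univ] at h1
        have h2 := measureReal_union_le (μ := P) ({ω | X t ω ∈ A} ∪ {ω | X t ω ∈ B})
          {ω | ENNReal.ofReal R ≤ f (X t ω)}
        have h3 := measureReal_union_le (μ := P) {ω | X t ω ∈ A} {ω | X t ω ∈ B}
        simp only [hm]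
        linarith
      have hgain : P {ω | X t ω ∈ A} + q ^ n * P {ω | X t ω ∈ B} ≤ P {ω | X (t + n) ω ∈ A} := by
        rw [← hlin t A, ← hlin t B, ← hlin (t + n) A,
          lintegral_add_eq_transition_iterate hE hind hlaw h0 hX,
          ← lintegral_const_mul _ (measurable_comp_history hE h0 hX t _),
          ← lintegral_add_left (measurable_comp_history hE h0 hX t _)]
        refine lintegral_mono fun ω => ?_
        obtain ⟨k1, k2⟩ := pow_le_transition_iterate hw hq hI hA n (X t ω)
        by_cases hωA : X t ω ∈ A
        · have hωB : X t ω ∉ B := fun hb => hb.1 hωA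
          simp [hωA, hωB, k1 hωA]
        by_cases hωB : X t ω ∈ B
        · simpa [hωA, hωB] using k2 (hn _ (hD t ω) hωB.2)
        · simp [hωA, hωB]
      have hgain' : m t + q.toReal ^ n * P.real {ω | X t ω ∈ B} ≤ m (t + n) := by
        have := ENNReal.toReal_mono (measure_ne_top _ _) hgain
        rwa [ENNReal.toReal_add (measure_ne_top _ _)
          (ENNReal.mul_ne_top (ENNReal.pow_ne_top hqtop) (measure_ne_top _ _)),
          ENNReal.toReal_mul, ENNReal.toReal_pow] at this
      have hqn : 0 ≤ q.toReal ^ n := pow_nonneg ENNReal.toReal_nonneg n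
      have : q.toReal ^ n * (1 - m t - M.toReal / R) ≤ q.toReal ^ n * P.real {ω | X t ω ∈ B} :=
        mul_le_mul_of_nonneg_left (by linarith) hqn
      linarith
    have hlim' : Tendsto (fun t => m (t + n)) atTop (𝓝 (⨆ t, m t)) :=
      hlim.comp (tendsto_add_atTop_nat n)
    have hlimit := le_of_tendsto_of_tendsto' (hlim.add
      (((tendsto_const_nhds.sub hlim).sub_const _).const_mul _)) hlim' hstep
    have hqn : 0 < q.toReal ^ n := pow_pos (ENNReal.toReal_pos hq0 hqtop) n
    by_contra hcon
    have : 0 < q.toReal ^ n * (1 - (⨆ t, m t) - M.toReal / R) := mul_pos hqn (by linarith)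
    linarith
  have hone : 1 ≤ ⨆ t, m t := by
    have hlimR : Tendsto (fun R : ℝ => 1 - M.toReal / R) atTop (𝓝 (1 - 0)) :=
      tendsto_const_nhds.sub (tendsto_const_nhds.div_atTop tendsto_id)
    rw [sub_zero] at hlimR
    exact le_of_tendsto hlimR ((eventually_gt_atTop 0).mono step)
  have hreal : P.real {ω | ∃ t, X t ω ∈ A} = 1 :=
    le_antisymm measureReal_le_one (hone.trans (ciSup_le hle1))
  have hmeasU : MeasurableSet {ω | ∃ t, X t ω ∈ A} := by
    rw [Set.ofPred_exists]
    exact MeasurableSet.iUnion fun t => hset t A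
  refine (mem_ae_iff_prob_eq_one hmeasU).2 ?_
  rwa [measureReal_def, ENNReal.toReal_eq_one_iff] at hreal

end RandomIteration

/-! ### Drift of the spread and absorption of the trajectory. -/

namespace SignedGraph

variable {V : Type*} {G : SignedGraph V} {σ : V → ℝ} {α β c : ℝ}

theorem rpow_neg_le_add_of_min_le {C k d y s : ℝ} (hC : 0 < C) (hk : 0 < k) (hd : 0 < d)
    (hs : 0 < s) (h : min C (k * d) ≤ y) : y ^ (-s) ≤ C ^ (-s) + k ^ (-s) * d ^ (-s) := by
  have h1 : 0 ≤ C ^ (-s) := Real.rpow_nonneg hC.le _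
  have h2 : 0 ≤ k ^ (-s) * d ^ (-s) :=
    mul_nonneg (Real.rpow_nonneg hk.le _) (Real.rpow_nonneg hd.le _)
  rcases min_le_iff.1 h with h | h
  · have := Real.rpow_le_rpow_of_nonpos hC h (neg_nonpos.2 hs.le)
    linarith
  · have := Real.rpow_le_rpow_of_nonpos (mul_pos hk hd) h (neg_nonpos.2 hs.le)
    rw [Real.mul_rpow hk.le hd.le] at this
    linarith

/-- At `s = 0` the left side is `1 - q`, strictly below the bound; continuity leaves room for a
positive `s`. -/
theorem exists_rpow_neg_exponent {a q : ℝ} (ha : 0 < a) (hq : 0 < q) :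
    ∃ s : ℝ, 0 < s ∧ (1 - q) * a ^ (-s) < 1 - q / 2 := by
  have hcont : Continuous fun s : ℝ => (1 - q) * a ^ (-s) :=
    continuous_const.mul ((Real.continuous_const_rpow ha.ne').comp continuous_neg)
  have hlim : Tendsto (fun s : ℝ => (1 - q) * a ^ (-s)) (𝓝[>] 0) (𝓝 ((1 - q) * a ^ (-(0 : ℝ)))) :=
    hcont.continuousAt.tendsto.mono_left nhdsWithin_le_nhds
  have hlt : (1 - q) * a ^ (-(0 : ℝ)) < 1 - q / 2 := by
    rw [neg_zero, Real.rpow_zero]; linarith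
  obtain ⟨s, h1, h2⟩ := ((hlim.eventually_lt_const hlt).and self_mem_nhdsWithin).exists
  exact ⟨s, h2, h1⟩

/-- The drift inequality for a negative power of the spread. -/
theorem IsBalancing.sum_mul_spread_rpow_le [Finite V] [Fintype (Sym2 V)] (h : G.IsBalancing σ)
    (h1 : ∃ i, σ i = 1) (h2 : ∃ i, σ i = -1) (hα : α ∈ Set.Ioo (0 : ℝ) (1 / 2)) (hβ : 0 < β)
    (hc : 0 < c) {r : Sym2 V → ℝ} (hr0 : ∀ e, 0 ≤ r e) (hr1 : ∑ e, r e = 1) {q : ℝ}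
    (hq : ∀ e ∈ G.graph.edgeSet, q ≤ r e) {s : ℝ} (hs : 0 < s)
    (hβs : ((1 + β) / 2) ^ (-s) ≤ 1 / 2) {x : V → ℝ} (hx : ∀ i, x i ∈ Set.Icc (-c) c)
    (hd : 0 < spread x) :
    ∑ e, r e * spread (G.interact α β c e x) ^ (-s) ≤
      (q / 2 + (1 - q) * (1 - 2 * α) ^ (-s)) * spread x ^ (-s) + (2 * c) ^ (-s) := by
  classical
  obtain ⟨hα0, hα1⟩ := hα
  have ha0 : 0 < 1 - 2 * α := by linarith
  set L := (1 - 2 * α) ^ (-s) with hL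
  set D := spread x ^ (-s) with hD
  set C := (2 * c) ^ (-s) with hC
  have hD0 : 0 ≤ D := Real.rpow_nonneg hd.le _
  have hC0 : 0 ≤ C := Real.rpow_nonneg (by linarith) _
  have hL1 : 1 ≤ L := Real.one_le_rpow_of_pos_of_le_one_of_nonpos ha0 (by linarith) (by linarith)
  have hall : ∀ e, spread (G.interact α β c e x) ^ (-s) ≤ L * D := by
    intro e
    rw [hL, hD, ← Real.mul_rpow ha0.le hd.le]
    exact Real.rpow_le_rpow_of_nonpos (mul_pos ha0 hd)
      (h.spread_interact_ge ⟨hα0, hα1⟩ hβ hc e hx) (by linarith)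
  obtain ⟨a, b, hab, hge⟩ := h.exists_half_spread_le h1 h2 x
  have hgood : spread (G.interact α β c s(a, b) x) ^ (-s) ≤ C + 1 / 2 * D := by
    have hmin : min (2 * c) ((1 + β) / 2 * spread x) ≤ spread (G.interact α β c s(a, b) x) := by
      refine le_trans (min_le_min le_rfl ?_)
        (h.min_le_spread_interact hβ hc hab hx (by linarith))
      have := mul_le_mul_of_nonneg_left hge (by linarith : (0 : ℝ) ≤ 1 + β)
      linarith
    have := rpow_neg_le_add_of_min_le (by linarith) (by linarith) hd hs hmin
    have hmul := mul_le_mul_of_nonneg_right hβs hD0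
    linarith
  have hqr : q ≤ r s(a, b) :=
    hq _ ((SimpleGraph.mem_edgeSet _).2 (h.graph_adj (h.ne_of_opposite hab)))
  have hsum := Finset.add_sum_erase Finset.univ r (Finset.mem_univ s(a, b))
  rw [hr1] at hsum
  have hrest : ∑ e ∈ Finset.univ.erase s(a, b), r e * spread (G.interact α β c e x) ^ (-s) ≤
      (1 - r s(a, b)) * (L * D) := by
    rw [← hsum, add_sub_cancel_left, Finset.sum_mul]
    exact Finset.sum_le_sum fun e _ => mul_le_mul_of_nonneg_left (hall e) (hr0 e)
  rw [← Finset.add_sum_erase _ _ (Finset.mem_univ s(a, b))]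
  set ρ := r s(a, b) with hρ
  have hρ0 : 0 ≤ ρ := hr0 _
  have hρ1 : ρ ≤ 1 := by
    have : 0 ≤ ∑ e ∈ Finset.univ.erase s(a, b), r e := Finset.sum_nonneg fun e _ => hr0 e
    linarith
  have t1 : ρ * spread (G.interact α β c s(a, b) x) ^ (-s) ≤ ρ * (C + 1 / 2 * D) :=
    mul_le_mul_of_nonneg_left hgood hρ0
  have t2 : ρ * C ≤ C := mul_le_of_le_one_left hC0 hρ1
  -- The coefficient `ρ / 2 + (1 - ρ) * L` decreases in `ρ`, as `L ≥ 1`, so `ρ` may be replaced by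
  -- its lower bound `q`.
  have t3 : 0 ≤ (ρ - q) * ((L - 1 / 2) * D) :=
    mul_nonneg (by linarith) (mul_nonneg (by linarith) hD0)
  nlinarith

theorem trajectory_mem_Icc (G : SignedGraph V) (α β : ℝ) (hc : 0 < c) {x₀ : V → ℝ}
    (hx : ∀ i, x₀ i ∈ Set.Icc (-c) c) (e : ℕ → Sym2 V) (t : ℕ) :
    ∀ i, G.trajectory α β c x₀ e t i ∈ Set.Icc (-c) c := by
  induction t with
  | zero => exact hx
  | succ t ih => exact interact_mem_Icc G α β hc (e t) ih

theorem IsBalancing.spread_trajectory_pos [Finite V] (h : G.IsBalancing σ)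
    (hα : α ∈ Set.Ioo (0 : ℝ) (1 / 2)) (hβ : 0 < β) (hc : 0 < c) {x₀ : V → ℝ}
    (hx : ∀ i, x₀ i ∈ Set.Icc (-c) c) (hd : 0 < spread x₀) (e : ℕ → Sym2 V) (t : ℕ) :
    0 < spread (G.trajectory α β c x₀ e t) := by
  induction t with
  | zero => exact hd
  | succ t ih =>
    have ha0 : 0 < 1 - 2 * α := by linarith [hα.2]
    exact (mul_pos ha0 ih).trans_le
      (h.spread_interact_ge hα hβ hc (e t) (trajectory_mem_Icc G α β hc hx e t))

theorem IsBalancing.ae_exists_polarized [Finite V] (h : G.IsBalancing σ)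
    (h1 : ∃ i, σ i = 1) (h2 : ∃ i, σ i = -1) (hα : α ∈ Set.Ioo (0 : ℝ) (1 / 2)) (hβ : 0 < β)
    (hc : 0 < c) (p : PMF (Sym2 V)) {q : ℝ} (hq0 : 0 < q) (hq1 : q ≤ 1)
    (hq : ∀ e ∈ G.graph.edgeSet, q ≤ (p e).toReal) {s : ℝ} (hs : 0 < s)
    (hsq : (1 - q) * (1 - 2 * α) ^ (-s) < 1 - q / 2) (hβs : ((1 + β) / 2) ^ (-s) ≤ 1 / 2)
    {Ω : Type*} [MeasurableSpace Ω] {P : Measure Ω} [IsProbabilityMeasure P]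
    {E : ℕ → Ω → Sym2 V} (hE : IsRandomPairSelection p P E) {x₀ : V → ℝ}
    (hx : ∀ i, x₀ i ∈ Set.Icc (-c) c) (hd : 0 < spread x₀) :
    ∀ᵐ ω ∂P, ∃ t, G.trajectory α β c x₀ (fun s => E s ω) t ∈ polarized c σ := by
  have := Fintype.ofFinite (Sym2 V)
  let _ : MeasurableSpace (Sym2 V) := ⊤
  have hw : ∑ e, p e = 1 := (tsum_fintype (fun e => p e)).symm.trans p.tsum_coe
  have hr1 : ∑ e, (p e).toReal = 1 := by
    rw [← ENNReal.toReal_sum fun e _ => p.apply_ne_top e, hw, ENNReal.toReal_one]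
  set X : ℕ → Ω → V → ℝ := fun t ω => G.trajectory α β c x₀ (fun s => E s ω) t with hXdef
  have hX : ∀ t ω, X (t + 1) ω = G.interact α β c (E t ω) (X t ω) := fun _ _ => rfl
  have hD : ∀ t ω, X t ω ∈ {x : V → ℝ | (∀ i, x i ∈ Set.Icc (-c) c) ∧ 0 < spread x} := fun t ω =>
    ⟨trajectory_mem_Icc G α β hc hx _ t, h.spread_trajectory_pos hα hβ hc hx hd _ t⟩
  set ρ := q / 2 + (1 - q) * (1 - 2 * α) ^ (-s) with hρ
  set C := (2 * c) ^ (-s) with hC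
  -- The initial value plus the fixed point of `y ↦ ρ * y + C`: a bound preserved by the drift
  -- recursion.
  set M := spread x₀ ^ (-s) + C / (1 - ρ) with hM
  have hρ1 : ρ < 1 := by linarith
  have hρ0 : 0 ≤ ρ := add_nonneg (by linarith)
    (mul_nonneg (by linarith) (Real.rpow_nonneg (by linarith [hα.2]) _))
  have hC0 : 0 ≤ C := Real.rpow_nonneg (by linarith) _
  have hV0 : 0 ≤ spread x₀ ^ (-s) := Real.rpow_nonneg hd.le _
  have hCM : 0 ≤ C / (1 - ρ) := div_nonneg hC0 (by linarith)
  have hMstep : ρ * M + C ≤ M := by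
    have hCe : C = (1 - ρ) * (C / (1 - ρ)) := by
      rw [mul_div_cancel₀ _ (by linarith : (1 - ρ) ≠ 0)]
    have : ρ * spread x₀ ^ (-s) ≤ spread x₀ ^ (-s) := mul_le_of_le_one_left hV0 hρ1.le
    rw [hM]
    linarith
  have hbound : ∀ t, ∫⁻ ω, ENNReal.ofReal (spread (X t ω) ^ (-s)) ∂P ≤ ENNReal.ofReal M := by
    intro t
    induction t with
    | zero =>
      calc ∫⁻ ω, ENNReal.ofReal (spread (X 0 ω) ^ (-s)) ∂P
          = ENNReal.ofReal (spread x₀ ^ (-s)) := by simp [hXdef, trajectory]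
        _ ≤ _ := ENNReal.ofReal_le_ofReal (by linarith)
    | succ t ih =>
      have hmeas : Measurable fun ω => ENNReal.ofReal (spread (X t ω) ^ (-s)) :=
        measurable_comp_history hE.measurable (fun _ => rfl) hX t
          fun x => ENNReal.ofReal (spread x ^ (-s))
      rw [lintegral_succ_eq_transition hE.measurable hE.indep hE.law (fun _ => rfl) hX t
        fun x => ENNReal.ofReal (spread x ^ (-s))]
      calc ∫⁻ ω, transition p (G.interact α β c)
            (fun x => ENNReal.ofReal (spread x ^ (-s))) (X t ω) ∂P
          ≤ ∫⁻ ω, (ENNReal.ofReal ρ * ENNReal.ofReal (spread (X t ω) ^ (-s)) +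
              ENNReal.ofReal C) ∂P := by
            refine lintegral_mono fun ω => ?_
            obtain ⟨hbox, hpos⟩ := hD t ω
            have hdrift := h.sum_mul_spread_rpow_le h1 h2 hα hβ hc
              (fun e => ENNReal.toReal_nonneg) hr1 hq hs hβs hbox hpos
            have hterm : ∀ e, p e * ENNReal.ofReal (spread (G.interact α β c e (X t ω)) ^ (-s)) =
                ENNReal.ofReal ((p e).toReal * spread (G.interact α β c e (X t ω)) ^ (-s)) := by
              intro e
              rw [ENNReal.ofReal_mul ENNReal.toReal_nonneg, ENNReal.ofReal_toReal (p.apply_ne_top e)]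
            have hnn : ∀ e, 0 ≤ spread (G.interact α β c e (X t ω)) ^ (-s) := fun e =>
              Real.rpow_nonneg ((mul_nonneg (by linarith [hα.2]) hpos.le).trans
                (h.spread_interact_ge hα hβ hc e hbox)) _
            rw [← ENNReal.ofReal_mul hρ0, ← ENNReal.ofReal_add
              (mul_nonneg hρ0 (Real.rpow_nonneg hpos.le _)) hC0]
            simp only [transition, hterm]
            rw [← ENNReal.ofReal_sum_of_nonneg fun e _ =>
              mul_nonneg ENNReal.toReal_nonneg (hnn e)]
            exact ENNReal.ofReal_le_ofReal hdrift
        _ = ENNReal.ofReal ρ * ∫⁻ ω, ENNReal.ofReal (spread (X t ω) ^ (-s)) ∂P +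
              ENNReal.ofReal C := by
            rw [lintegral_add_right _ measurable_const, lintegral_const_mul _ hmeas]
            simp
        _ ≤ ENNReal.ofReal ρ * ENNReal.ofReal M + ENNReal.ofReal C := by gcongr
        _ ≤ ENNReal.ofReal M := by
            rw [← ENNReal.ofReal_mul hρ0, ← ENNReal.ofReal_add
              (mul_nonneg hρ0 (by linarith)) hC0]
            exact ENNReal.ofReal_le_ofReal hMstep
  refine ae_exists_mem_of_tight (q := ENNReal.ofReal q) (I := G.graph.edgeSet)
    (f := fun x => ENNReal.ofReal (spread x ^ (-s)))
    hE.measurable hE.indep hE.law hw (fun _ => rfl) hX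
    (ENNReal.ofReal_pos.2 hq0).ne' (ENNReal.ofReal_le_one.2 hq1)
    (fun e he => (ENNReal.ofReal_le_iff_le_toReal (p.apply_ne_top e)).2 (hq e he))
    (fun e x hxA => by rwa [h.interact_polarized hβ hc e hxA]) hD ENNReal.ofReal_ne_top hbound ?_
  intro R hR
  -- The maximum with 1 keeps the base positive when `R = 0`. The threshold `δ` is the spread at
  -- which `spread ^ (-s)` equals this maximum.
  have hR' : 0 < max R.toReal 1 := lt_max_of_lt_right one_pos
  obtain ⟨n, hn⟩ := h.exists_canReach h1 h2 hα hβ hc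
    (Real.rpow_pos_of_pos hR' (-(1 / s)))
  refine ⟨n, fun x hxD hxR => hn x hxD.1 (le_of_not_gt fun hlt => ?_)⟩
  have hge := Real.rpow_le_rpow_of_nonpos hxD.2 hlt.le (neg_nonpos.2 hs.le)
  rw [← Real.rpow_mul hR'.le, neg_mul_neg, one_div_mul_cancel hs.ne', Real.rpow_one] at hge
  have hlt' := (ENNReal.ofReal_lt_iff_lt_toReal (Real.rpow_nonneg hxD.2.le _) hR).1 hxR
  linarith [le_max_left R.toReal 1]

theorem IsBalancing.trajectory_add_eq (h : G.IsBalancing σ) (hβ : 0 < β) (hc : 0 < c) {x₀ : V → ℝ}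
    {e : ℕ → Sym2 V} {t : ℕ} (ht : G.trajectory α β c x₀ e t ∈ polarized c σ) (k : ℕ) :
    G.trajectory α β c x₀ e (t + k) = G.trajectory α β c x₀ e t := by
  induction k with
  | zero => rfl
  | succ k ih =>
    rw [← add_assoc, trajectory, ih]
    exact h.interact_polarized hβ hc _ ht

theorem IsBalancing.tendsto_trajectory (h : G.IsBalancing σ) (hβ : 0 < β) (hc : 0 < c)
    {x₀ : V → ℝ} {e : ℕ → Sym2 V} {t : ℕ} (ht : G.trajectory α β c x₀ e t ∈ polarized c σ) (i : V) :
    Tendsto (fun t => G.trajectory α β c x₀ e t i) atTop (𝓝 (G.trajectory α β c x₀ e t i)) := by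
  refine tendsto_const_nhds.congr' ?_
  filter_upwards [eventually_ge_atTop t] with u hu
  obtain ⟨k, rfl⟩ := Nat.exists_eq_add_of_le hu
  rw [h.trajectory_add_eq hβ hc ht]

/-- Zero spread forces `x i = x j`, a proper subspace and hence a null set. -/
theorem IsBalancing.spread_pos_ae [Fintype V] (h : G.IsBalancing σ) (h1 : ∃ i, σ i = 1)
    (h2 : ∃ i, σ i = -1) : ∀ᵐ x : V → ℝ, 0 < spread x := by
  obtain ⟨i, hi⟩ := h1
  obtain ⟨j, hj⟩ := h2
  have hij : i ≠ j := h.ne_of_opposite (by rw [hi, hj, neg_neg])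
  let K : Submodule ℝ (V → ℝ) :=
    LinearMap.ker ((LinearMap.proj i : (V → ℝ) →ₗ[ℝ] ℝ) - LinearMap.proj j)
  have hK : K ≠ ⊤ := by
    classical
    intro htop
    have hmem : (Pi.single i 1 : V → ℝ) ∈ K := htop ▸ Submodule.mem_top
    simp [K, Pi.single_eq_of_ne hij.symm] at hmem
  have hnull := Measure.addHaar_submodule (volume : Measure (V → ℝ)) K hK
  have hae : ∀ᵐ x : V → ℝ, x ∉ K := by
    rw [ae_iff]; simpa using hnull
  filter_upwards [hae] with x hx
  have hne : x i - x j ≠ 0 := fun h0 => hx (by simpa [K] using h0)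
  rcases lt_or_gt_of_ne hne with hlt | hgt
  · linarith [sub_le_spread x j i]
  · linarith [sub_le_spread x i j]

open Classical in
theorem IsStructurallyBalanced.isBalancing {V₁ V₂ : Set V} (hcomplete : G.IsComplete)
    (hbal : G.IsStructurallyBalanced V₁ V₂) :
    G.IsBalancing fun i => if i ∈ V₁ then 1 else -1 := by
  have hadj : ∀ i j, i ≠ j → G.graph.Adj i j := fun i j hij => by
    rw [show G.graph = ⊤ from hcomplete]; exact hij
  have hV₂ : ∀ i, i ∉ V₁ → i ∈ V₂ := fun i hi =>
    ((Set.ext_iff.1 hbal.union_eq i).2 trivial).resolve_left hi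
  refine ⟨fun i => ?_, fun i j hij hs => ?_, fun i j hs => ?_⟩
  · by_cases hi : i ∈ V₁ <;> simp [hi]
  · by_cases hi : i ∈ V₁ <;> by_cases hj : j ∈ V₁ <;> simp only [hi, hj, if_true, if_false] at hs
    · exact hbal.pos_left i hi j hj (hadj i j hij)
    · norm_num at hs
    · norm_num at hs
    · exact hbal.pos_right i (hV₂ i hi) j (hV₂ j hj) (hadj i j hij)
  · by_cases hi : i ∈ V₁ <;> by_cases hj : j ∈ V₁ <;> simp only [hi, hj, if_true, if_false] at hs
    · norm_num at hs
    · exact hbal.neg_between i hi j (hV₂ j hj) (hadj i j (by rintro rfl; exact hj hi))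
    · exact (hbal.neg_between j hj i (hV₂ i hi) (hadj j i (by rintro rfl; exact hi hj))).symm
    · norm_num at hs

end SignedGraph

open SignedGraph in
theorem mainTheorem4 {V : Type*} [Fintype V] (G : SignedGraph V) (V₁ V₂ : Set V)
    (hcomplete : G.IsComplete) (hbal : G.IsStructurallyBalanced V₁ V₂)
    (p : PMF (Sym2 V)) (hp : p.support = G.graph.edgeSet)
    (α : ℝ) (hα : α ∈ Set.Ioo (0 : ℝ) (1 / 2)) :
    ∃ βstar : ℝ, 0 < βstar ∧ ∀ β : ℝ, βstar < β → ∀ c : ℝ, 0 < c →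
      ∀ (Ω : Type*) [MeasurableSpace Ω] (P : Measure Ω) [IsProbabilityMeasure P]
        (E : ℕ → Ω → Sym2 V), IsRandomPairSelection p P E →
        ∀ᵐ x₀ ∂((volume : Measure (V → ℝ)).restrict (Set.univ.pi fun _ => Set.Icc (-c) c)),
          ∃ l : Ω → ℝ, Measurable l ∧ (∀ ω, l ω = c ∨ l ω = -c) ∧
            ∀ᵐ ω ∂P,
              (∀ i ∈ V₁, Tendsto (fun t => G.trajectory α β c x₀ (fun s => E s ω) t i)
                atTop (𝓝 (l ω))) ∧
              (∀ i ∈ V₂, Tendsto (fun t => G.trajectory α β c x₀ (fun s => E s ω) t i)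
                atTop (𝓝 (-l ω))) := by
  classical
  obtain ⟨σ, hσ, hσ1, hσ2⟩ : ∃ σ : V → ℝ, G.IsBalancing σ ∧ (∀ i ∈ V₁, σ i = 1) ∧
      ∀ i ∈ V₂, σ i = -1 :=
    ⟨_, hbal.isBalancing hcomplete, fun i hi => if_pos hi,
      fun i hi => if_neg fun hi' => Set.disjoint_left.1 hbal.disjoint hi' hi⟩
  have h1 : ∃ i, σ i = 1 := hbal.nonempty_left.imp hσ1
  have h2 : ∃ i, σ i = -1 := hbal.nonempty_right.imp hσ2
  -- The least edge probability serves as `q`.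
  obtain ⟨e₀, he₀, hmin⟩ := Set.exists_min_image p.support (fun e => (p e).toReal)
    (Set.toFinite _) p.support_nonempty
  have hq0 : 0 < (p e₀).toReal :=
    ENNReal.toReal_pos ((p.mem_support_iff e₀).1 he₀) (p.apply_ne_top e₀)
  have hq1 : (p e₀).toReal ≤ 1 := 
    ENNReal.toReal_le_of_le_ofReal one_pos.le (by simpa using p.coe_le_one e₀)
  obtain ⟨s, hs, hsq⟩ := exists_rpow_neg_exponent (by linarith [hα.2] : 0 < 1 - 2 * α) hq0
  -- Beyond this threshold `(1 + β) / 2` exceeds `2 ^ (1 / s)`, whose power `-s` is `1 / 2`.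
  refine ⟨2 * 2 ^ (1 / s), by positivity, fun β hβs c hc Ω _ P _ E hE => ?_⟩
  have hpow : (0 : ℝ) < 2 ^ (1 / s) := by positivity
  have hβ : 0 < β := by linarith
  have hβs' : ((1 + β) / 2) ^ (-s) ≤ 1 / 2 := by
    have := Real.rpow_le_rpow_of_nonpos hpow (by linarith : (2 : ℝ) ^ (1 / s) ≤ (1 + β) / 2)
      (neg_nonpos.2 hs.le)
    rwa [← Real.rpow_mul two_pos.le, mul_neg, one_div_mul_cancel hs.ne', Real.rpow_neg_one,
      ← one_div] at this
  filter_upwards [ae_restrict_of_ae (hσ.spread_pos_ae h1 h2),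
    ae_restrict_mem (MeasurableSet.univ_pi fun _ => measurableSet_Icc)] with x₀ hd hbox
  have hx : ∀ i, x₀ i ∈ Set.Icc (-c) c := fun i => hbox i trivial
  have habs := hσ.ae_exists_polarized h1 h2 hα hβ hc p hq0 hq1
    (fun e he => hmin e (hp ▸ he)) hs hsq hβs' hE hx hd
  have hmeas : MeasurableSet {ω | ∃ t, G.trajectory α β c x₀ (fun s => E s ω) t = c • σ} := by
    let _ : MeasurableSpace (Sym2 V) := ⊤
    rw [Set.ofPred_exists]
    refine MeasurableSet.iUnion fun t => ?_
    have hm := measurable_comp_history (F := G.interact α β c) (x₀ := x₀)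
      (X := fun t ω => G.trajectory α β c x₀ (fun s => E s ω) t) hE.measurable
      (fun _ => rfl) (fun _ _ => rfl) t (fun x => x = c • σ)
    simpa using hm (MeasurableSet.singleton True)
  -- The value `-c` also serves as default on the null event without absorption.
  refine ⟨fun ω => if ∃ t, G.trajectory α β c x₀ (fun s => E s ω) t = c • σ then c else -c,
    Measurable.ite hmeas measurable_const measurable_const, fun ω => ?_, ?_⟩
  · dsimp only
    split_ifs <;> simp
  filter_upwards [habs] with ω ⟨t, ht⟩
  have hlim := hσ.tendsto_trajectory hβ hc ht
  by_cases hplus : ∃ t, G.trajectory α β c x₀ (fun s => E s ω) t = c • σ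
  · obtain ⟨u, hu⟩ := hplus
    have hlim' := hσ.tendsto_trajectory hβ hc (hu ▸ Or.inl rfl :
      G.trajectory α β c x₀ (fun s => E s ω) u ∈ polarized c σ)
    rw [if_pos ⟨u, hu⟩]
    refine ⟨fun i hi => ?_, fun i hi => ?_⟩
    · simpa [hu, hσ1 i hi] using hlim' i
    · simpa [hu, hσ2 i hi] using hlim' i
  · have hu : G.trajectory α β c x₀ (fun s => E s ω) t = -(c • σ) :=
      ht.resolve_left fun h => hplus ⟨t, h⟩
    rw [if_neg hplus]
    refine ⟨fun i hi => ?_, fun i hi => ?_⟩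
    · simpa [hu, hσ1 i hi] using hlim i
    · simpa [hu, hσ2 i hi] using hlim i
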